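/- Let $m>0$, $k>0$, $\bar\gamma>0$. The fdRLoS (fluctuating double-Rayleigh with line-of-sight) channel with shadowing parameter $m$, Rician factor $k$ and average SNR $\bar\gamma$ has instantaneous SNR with density $$f_\gamma(\gamma)=\int_0^\infty f_{\gamma_x}(\gamma|x)\,e^{-x}\,dx,\qquad f_{\gamma_x}(\gamma|x)=\frac{m^m(1+k_x)}{(m+k_x)^m\,\bar\gamma_x}\,e^{-\frac{1+k_x}{\bar\gamma_x}\gamma}\;{}_1F_1\!\left(m;1;\frac{k_x(1+k_x)}{k_x+m}\,\frac{\gamma}{\bar\gamma_x}\right),$$ where $k_x=k/x$ and $\bar\gamma_x=\frac{k+x}{k+1}\bar\gamma$. Let $\gamma_0>0$ be the cutoff of the optimal simultaneous power and rate adaptation strategy (OPRA), that is, $\int_{\gamma_0}^\infty\left(\frac1{\gamma_0}-\frac1\gamma\right)f_\gamma(\gamma)\,d\gamma=1$, and let $\bar C=\int_{\gamma_0}^\infty\log_2(\gamma/\gamma_0)\,f_\gamma(\gamma)\,d\gamma$ be the corresponding ergodic capacity. For $x,y>0$ and $i=0,1,2,\dots$ let $$G_i(x,y)=G_{1,1:3,2:0,1}^{1,1:0,3:1,0}\left(\begin{array}{c}-m\\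 i-1\end{array}\middle\vert\begin{array}{c}-i,1,1\\ 0,0\end{array}\middle\vert\begin{array}{c}\text{---}\\ 0\end{array}\middle\vert x,y\right)=\frac1{(2\pi j)^2}\int_{\mathcal L_s}\int_{\mathcal L_t}\Gamma(i-1+s+t)\,\Gamma(1+m-s-t)\,\frac{\Gamma(1+i-s)\,\Gamma(-s)^2}{\Gamma(1-s)^2}\,\Gamma(t)\,x^{-s}y^{-t}\,ds\,dt$$ be the extended generalized bivariate Meijer G-function (EGBMG), where $j$ is the imaginary unit and $\mathcal L_s=\{\operatorname{Re}s=\sigma\}$, $\mathcal L_t=\{\operatorname{Re}t=\rho\}$ are any vertical lines separating the poles, i.e. $\sigma<0<\rho$ and $1-i<\sigma+\rho<m+1$. Then $\log_2(\gamma/\gamma_0)f_\gamma(\gamma)$ is integrable on $(\gamma_0,\infty)$, for every $i$ such lines exist and the double integral converges absolutely for all of them with one and the same value, the series below converges absolutely, and $$\bar C=\frac{k}{\Gamma(m+1)\ln 2}\sum_{i=0}^\infty\frac{1}{(i!)^2}\,G_i\!\left(\frac{\bar\gamma k}{\gamma_0(k+1)m},\frac km\right).$$ -/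

import Mathlib

open MeasureTheory Set

noncomputable section

/-! ## The extended generalized bivariate Meijer G-function -/

/-- One parameter block `(a_1, …, a_p | b_1, …, b_q)` of a (bivariate) Meijer G-function, with
the orders `m` (number of numerator factors `Γ(b_j + τ)`) and `n` (number of numerator factors
`Γ(1 - a_j - τ)`); `p` and `q` are the lengths of the lists `a` and `b`. -/
structure MeijerBlock where
  m : ℕ
  n : ℕ
  a : List ℂ
  b : List ℂ

/-- `Ψ(τ) = ∏_{j ≤ m} Γ(b_j + τ) ∏_{j ≤ n} Γ(1 - a_j - τ) /
  (∏_{n < j ≤ p} Γ(a_j + τ) ∏_{m < j ≤ q} Γ(1 - b_j - τ))`. -/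
def MeijerBlock.psi (B : MeijerBlock) (τ : ℂ) : ℂ :=
  (((B.b.take B.m).map fun b => Complex.Gamma (b + τ)).prod *
      ((B.a.take B.n).map fun a => Complex.Gamma (1 - a - τ)).prod) /
    (((B.a.drop B.n).map fun a => Complex.Gamma (a + τ)).prod *
      ((B.b.drop B.m).map fun b => Complex.Gamma (1 - b - τ)).prod)

/-- The line `Re τ = c` separates the poles of the factors `Γ(b_j + τ)`, `j ≤ m`, which have to
lie to its left, from those of the factors `Γ(1 - a_j - τ)`, `j ≤ n`, to its right. -/
def MeijerBlock.Separates (B : MeijerBlock) (c : ℝ) : Prop :=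
  (∀ b ∈ B.b.take B.m, 0 < b.re + c) ∧ (∀ a ∈ B.a.take B.n, 0 < 1 - a.re - c)

/-- The vertical contours `Re s = σ`, `Re t = ρ` separate the two families of poles of
`Ψ₁(s + t) Ψ₂(s) Ψ₃(t)`. -/
def SeparatingContours (B₁ B₂ B₃ : MeijerBlock) (σ ρ : ℝ) : Prop :=
  B₁.Separates (σ + ρ) ∧ B₂.Separates σ ∧ B₃.Separates ρ

/-- The integrand `Ψ₁(s + t) Ψ₂(s) Ψ₃(t) x^{-s} y^{-t}`. -/
def egbmgIntegrand (B₁ B₂ B₃ : MeijerBlock) (x y s t : ℂ) : ℂ :=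
  B₁.psi (s + t) * B₂.psi s * B₃.psi t * x ^ (-s) * y ^ (-t)

/-- The point `c + j v` of the vertical line `Re τ = c`. -/
def verticalLine (c v : ℝ) : ℂ := (c : ℂ) + Complex.I * (v : ℂ)

/-- The double Mellin–Barnes integral
`(2πj)⁻² ∫_{Re s = σ} ∫_{Re t = ρ} Ψ₁(s + t) Ψ₂(s) Ψ₃(t) x^{-s} y^{-t} ds dt`;
the factors `Complex.I` under the integral come from `ds = j du` and `dt = j dv`. -/
def doubleMellinBarnes (B₁ B₂ B₃ : MeijerBlock) (x y : ℂ) (σ ρ : ℝ) : ℂ :=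
  1 / (2 * (Real.pi : ℂ) * Complex.I) ^ 2 *
    ∫ u : ℝ, ∫ v : ℝ,
      egbmgIntegrand B₁ B₂ B₃ x y (verticalLine σ u) (verticalLine ρ v) * Complex.I * Complex.I

/-- The EGBMG with parameter blocks `B₁, B₂, B₃` is well defined at `(x, y)` with value `G`:
there are separating vertical contours, and along any such pair of contours the double
Mellin–Barnes integral converges absolutely and equals `G`. -/
def HasEGBMG (B₁ B₂ B₃ : MeijerBlock) (x y G : ℂ) : Prop :=
  (∃ σ ρ : ℝ, SeparatingContours B₁ B₂ B₃ σ ρ) ∧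
    ∀ σ ρ : ℝ, SeparatingContours B₁ B₂ B₃ σ ρ →
      Integrable (fun w : ℝ × ℝ =>
        egbmgIntegrand B₁ B₂ B₃ x y (verticalLine σ w.1) (verticalLine ρ w.2)) ∧
      doubleMellinBarnes B₁ B₂ B₃ x y σ ρ = G

open Classical in
/-- The value of the EGBMG at `(x, y)` (and `0` if it is not well defined there). -/
def egbmg (B₁ B₂ B₃ : MeijerBlock) (x y : ℂ) : ℂ :=
  if h : ∃ G, HasEGBMG B₁ B₂ B₃ x y G then h.choose else 0

/-! ## The fdRLoS fading channel -/

/-- The confluent hypergeometric function `₁F₁(a; b; z)` of real arguments. -/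
def confluentHypergeometric (a b z : ℝ) : ℝ :=
  ∑' n : ℕ, (ascPochhammer ℝ n).eval a / ((ascPochhammer ℝ n).eval b * (n.factorial : ℝ)) * z ^ n

/-- The density of the instantaneous SNR, conditional on `x = |G₃|²`, with shadowing parameter `m`,
Rician factor `k` and average SNR `γbar`; here `k_x = k / x` and
`γbar_x = (k + x) / (k + 1) * γbar`. -/
def fdRLoSCondPDF (m k γbar x γ : ℝ) : ℝ :=
  let kx := k / x
  let γx := (k + x) / (k + 1) * γbar
  m ^ m * (1 + kx) / ((m + kx) ^ m * γx) * Real.exp (-((1 + kx) / γx * γ)) *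
    confluentHypergeometric m 1 (kx * (1 + kx) / (kx + m) * (γ / γx))

/-- The density of the instantaneous SNR of the fdRLoS channel. -/
def fdRLoSPDF (m k γbar γ : ℝ) : ℝ :=
  ∫ x in Ioi (0 : ℝ), fdRLoSCondPDF m k γbar x γ * Real.exp (-x)

/-- `γ₀` is the optimal cut-off SNR of the OPRA strategy:
`∫_{γ₀}^∞ (1/γ₀ - 1/γ) f(γ) dγ = 1`. -/
def IsOPRACutoff (m k γbar γ₀ : ℝ) : Prop :=
  0 < γ₀ ∧ ∫ γ in Ioi γ₀, (1 / γ₀ - 1 / γ) * fdRLoSPDF m k γbar γ = 1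

/-- The integrand `log₂(γ / γ₀) f(γ)` of the OPRA ergodic capacity. -/
def opraIntegrand (m k γbar γ₀ γ : ℝ) : ℝ :=
  Real.logb 2 (γ / γ₀) * fdRLoSPDF m k γbar γ

/-- The OPRA ergodic capacity (per unit bandwidth) of the fdRLoS channel. -/
def opraCapacity (m k γbar γ₀ : ℝ) : ℝ :=
  ∫ γ in Ioi γ₀, opraIntegrand m k γbar γ₀ γ

/-- The first parameter block of the `i`-th term of the capacity series, whose function is
`G^{1,1:0,3:1,0}_{1,1:3,2:0,1}(-m ; i-1 | -i,1,1 ; 0,0 | - ; 0 | x, y)`. -/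
def opraBlock₁ (m : ℝ) (i : ℕ) : MeijerBlock := ⟨1, 1, [-(m : ℂ)], [(i : ℂ) - 1]⟩

/-- The second parameter block of the `i`-th term. -/
def opraBlock₂ (i : ℕ) : MeijerBlock := ⟨0, 3, [-(i : ℂ), 1, 1], [0, 0]⟩

/-- The third parameter block of every term. -/
def opraBlock₃ : MeijerBlock := ⟨1, 0, [], [0]⟩

end

/-! Both sides are reduced to the same iterated real integral `opraRealIntegral`.

On the Mellin–Barnes side, every factor of the integrand is a Mellin transform. Since Γ(1-s) =
-sΓ(-s), the quotient Γ(-s)²/Γ(1-s)² is 1/s², the transform of log⁺ for Re s < 0. The other factors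
come from Gamma integrals (Γ(t) from e^{-x}, Γ(1+i-s) from v^i e^{-v}) and from the Beta integral:
Γ(1+m-w)Γ(i-1+w) = ∫ α(x) x^{-w} dx with α(x) = Γ(m+i) x^m (1+x)^{-(m+i)}. With w = s+t, Fubini
decouples the two contour integrals into inverse Mellin transforms under one integral over x
(`integral_mellinBarnes_eq`). The result does not depend on the contours (`hasEGBMG_opra`).

On the channel side, expanding ₁F₁ makes the joint density of γ and x a nonnegative series of Gamma
densities in γ with rate b = (k+1)/(γbar x). Integrating one term against log₂(γ/γ₀), with v = bγ
and y = mx/k, gives the same real integral (`integral_opraTerm`).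

Exchanging sum and integrals rests on `tsum_lintegral_opraTerm_ne_top`: after log u ≤ u the sum over
n is a binomial series, which leaves an affine function of x times e^{-x}. -/

/-! ### Inverse Mellin transforms of products and coupled double integrals -/

open Filter in
theorem verticalIntegrable_comp_cpow_neg {B : ℂ → ℂ} {σ : ℝ} (hB : Complex.VerticalIntegrable B σ)
    {z : ℝ} (hz : 0 < z) :
    Integrable (fun u : ℝ => (z : ℂ) ^ (-((σ : ℂ) + u * Complex.I)) * B (σ + u * Complex.I)) := by
  have hz' : (z : ℂ) ≠ 0 := by exact_mod_cast hz.ne'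
  refine Integrable.bdd_mul (c := z ^ (-σ)) hB ?_ ?_
  · refine Continuous.aestronglyMeasurable ?_
    refine Continuous.const_cpow (by fun_prop) (Or.inl hz')
  · refine Eventually.of_forall fun u => ?_
    rw [Complex.norm_cpow_eq_rpow_re_of_pos hz]
    simp

/-- A factor `A (s) = ∫ α (x) x ^ (-s) dx` of the integrand of an inverse Mellin transform can be
pulled out of the transform. -/
theorem mellinInv_mul_eq_integral {α : ℝ → ℂ} {A B : ℂ → ℂ} {σ z : ℝ} (hz : 0 < z)
    (hα : IntegrableOn (fun x : ℝ => α x * (x : ℂ) ^ (-(σ : ℂ))) (Ioi 0))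
    (hA : ∀ s : ℂ, s.re = σ → ∫ x in Ioi (0 : ℝ), α x * (x : ℂ) ^ (-s) = A s)
    (hB : Complex.VerticalIntegrable B σ) :
    mellinInv σ (fun s => A s * B s) z = ∫ x in Ioi (0 : ℝ), α x * mellinInv σ B (z * x) := by
  have hint : Integrable (fun p : ℝ × ℝ => (α p.1 * (p.1 : ℂ) ^ (-((σ : ℂ) + p.2 * Complex.I))) *
      ((z : ℂ) ^ (-((σ : ℂ) + p.2 * Complex.I)) * B (σ + p.2 * Complex.I)))
      ((volume.restrict (Ioi 0)).prod volume) := by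
    have h := hα.integrable.mul_prod (verticalIntegrable_comp_cpow_neg hB hz)
    -- On the line, x^{-s} is x^{-σ} times a unimodular phase, so absolute integrability is that of
    -- a product of a function of x and a function of u.
    have h2 := h.bdd_mul (f := fun p : ℝ × ℝ => (p.1 : ℂ) ^ (-(p.2 * Complex.I)) )
      (c := 1) ?_ ?_
    · refine h2.congr ?_
      have : ∀ᵐ p : ℝ × ℝ ∂((volume.restrict (Ioi 0)).prod volume), 0 < p.1 := by
        refine Measure.quasiMeasurePreserving_fst.ae ?_
        exact ae_restrict_mem measurableSet_Ioi
      filter_upwards [this] with p hp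
      have hp' : (p.1 : ℂ) ≠ 0 := by exact_mod_cast hp.ne'
      rw [neg_add, Complex.cpow_add _ _ hp']
      ring
    · exact Measurable.aestronglyMeasurable (by fun_prop)
    · have : ∀ᵐ p : ℝ × ℝ ∂((volume.restrict (Ioi 0)).prod volume), 0 < p.1 := by
        refine Measure.quasiMeasurePreserving_fst.ae ?_
        exact ae_restrict_mem measurableSet_Ioi
      filter_upwards [this] with p hp
      rw [Complex.norm_cpow_eq_rpow_re_of_pos hp]
      simp
  have hswap := integral_integral_swap (μ := volume.restrict (Ioi (0 : ℝ))) (ν := volume)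
    (f := fun x u : ℝ => (α x * (x : ℂ) ^ (-((σ : ℂ) + u * Complex.I))) *
      ((z : ℂ) ^ (-((σ : ℂ) + u * Complex.I)) * B (σ + u * Complex.I))) hint
  simp only [mellinInv]
  calc _ = (1 / (2 * Real.pi)) • ∫ u : ℝ, ∫ x in Ioi (0 : ℝ),
      (α x * (x : ℂ) ^ (-((σ : ℂ) + u * Complex.I))) *
      ((z : ℂ) ^ (-((σ : ℂ) + u * Complex.I)) * B (σ + u * Complex.I)) := by
        congr 2 with u
        rw [integral_mul_const, hA _ (by simp), smul_eq_mul]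
        ring
    _ = _ := by
        rw [← hswap, ← integral_smul]
        refine setIntegral_congr_fun measurableSet_Ioi fun x hx => ?_
        rw [mem_Ioi] at hx
        rw [mul_smul_comm]
        congr 1
        rw [← integral_const_mul]
        congr 1 with u
        rw [Complex.ofReal_mul, Complex.mul_cpow_ofReal_nonneg hz.le hx.le, smul_eq_mul]
        ring

/-- A double Mellin–Barnes integral with a coupling factor `A (s + t)`, `A (w) = ∫ α (x) x ^ (-w) dx`,
converges absolutely and reduces to a single integral of inverse Mellin transforms. -/
theorem integral_mellinBarnes_eq {α : ℝ → ℂ} {A B C : ℂ → ℂ} {σ ρ X Y : ℝ}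
    (hX : 0 < X) (hY : 0 < Y)
    (hα : IntegrableOn (fun x : ℝ => α x * (x : ℂ) ^ (-((σ + ρ : ℝ) : ℂ))) (Ioi 0))
    (hA : ∀ w : ℂ, w.re = σ + ρ → ∫ x in Ioi (0 : ℝ), α x * (x : ℂ) ^ (-w) = A w)
    (hB : Complex.VerticalIntegrable B σ) (hC : Complex.VerticalIntegrable C ρ) :
    Integrable (fun p : ℝ × ℝ => A ((σ + p.1 * Complex.I) + (ρ + p.2 * Complex.I)) *
      B (σ + p.1 * Complex.I) * C (ρ + p.2 * Complex.I) *
      (X : ℂ) ^ (-((σ : ℂ) + p.1 * Complex.I)) * (Y : ℂ) ^ (-((ρ : ℂ) + p.2 * Complex.I))) ∧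
    ∫ u : ℝ, ∫ v : ℝ, A ((σ + u * Complex.I) + (ρ + v * Complex.I)) *
      B (σ + u * Complex.I) * C (ρ + v * Complex.I) *
      (X : ℂ) ^ (-((σ : ℂ) + u * Complex.I)) * (Y : ℂ) ^ (-((ρ : ℂ) + v * Complex.I)) =
    (2 * Real.pi) ^ 2 *
      ∫ x in Ioi (0 : ℝ), α x * mellinInv σ B (X * x) * mellinInv ρ C (Y * x) := by
  have hpos : ∀ᵐ p : ℝ × (ℝ × ℝ) ∂((volume.restrict (Ioi 0)).prod volume), 0 < p.1 :=
    Measure.quasiMeasurePreserving_fst.ae (ae_restrict_mem measurableSet_Ioi)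
  have hint : Integrable (fun p : ℝ × (ℝ × ℝ) =>
      (α p.1 * (p.1 : ℂ) ^ (-(((σ : ℂ) + p.2.1 * Complex.I) + (ρ + p.2.2 * Complex.I)))) *
      (((X : ℂ) ^ (-((σ : ℂ) + p.2.1 * Complex.I)) * B (σ + p.2.1 * Complex.I)) *
      ((Y : ℂ) ^ (-((ρ : ℂ) + p.2.2 * Complex.I)) * C (ρ + p.2.2 * Complex.I))))
      ((volume.restrict (Ioi 0)).prod volume) := by
    have h := hα.integrable.mul_prod ((verticalIntegrable_comp_cpow_neg hB hX).mul_prod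
      (verticalIntegrable_comp_cpow_neg hC hY))
    have h2 := h.bdd_mul
      (f := fun p : ℝ × (ℝ × ℝ) => (p.1 : ℂ) ^ (-((p.2.1 + p.2.2) * Complex.I)) ) (c := 1) ?_ ?_
    · refine h2.congr ?_
      filter_upwards [hpos] with p hp
      have hp' : (p.1 : ℂ) ≠ 0 := by exact_mod_cast hp.ne'
      have : -(((σ : ℂ) + p.2.1 * Complex.I) + (ρ + p.2.2 * Complex.I)) =
        -((p.2.1 + p.2.2) * Complex.I) + -((σ + ρ : ℝ) : ℂ) := by push_cast; ring
      rw [this, Complex.cpow_add _ _ hp']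
      ring
    · exact Measurable.aestronglyMeasurable (by fun_prop)
    · filter_upwards [hpos] with p hp
      rw [Complex.norm_cpow_eq_rpow_re_of_pos hp]
      simp
  have hinner : ∀ p : ℝ × ℝ, ∫ x in Ioi (0 : ℝ),
      (α x * (x : ℂ) ^ (-(((σ : ℂ) + p.1 * Complex.I) + (ρ + p.2 * Complex.I)))) *
      (((X : ℂ) ^ (-((σ : ℂ) + p.1 * Complex.I)) * B (σ + p.1 * Complex.I)) *
      ((Y : ℂ) ^ (-((ρ : ℂ) + p.2 * Complex.I)) * C (ρ + p.2 * Complex.I))) =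
      A ((σ + p.1 * Complex.I) + (ρ + p.2 * Complex.I)) *
      B (σ + p.1 * Complex.I) * C (ρ + p.2 * Complex.I) *
      (X : ℂ) ^ (-((σ : ℂ) + p.1 * Complex.I)) * (Y : ℂ) ^ (-((ρ : ℂ) + p.2 * Complex.I)) := by
    intro p
    rw [integral_mul_const, hA _ (by simp)]
    ring
  have hI := hint.integral_prod_right
  simp only [hinner] at hI
  refine ⟨hI, ?_⟩
  rw [integral_integral hI]
  have hswap := integral_integral_swap (μ := volume.restrict (Ioi (0 : ℝ)))
    (ν := (volume : Measure (ℝ × ℝ)))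
    (f := fun (x : ℝ) (p : ℝ × ℝ) =>
      (α x * (x : ℂ) ^ (-(((σ : ℂ) + p.1 * Complex.I) + (ρ + p.2 * Complex.I)))) *
      (((X : ℂ) ^ (-((σ : ℂ) + p.1 * Complex.I)) * B (σ + p.1 * Complex.I)) *
      ((Y : ℂ) ^ (-((ρ : ℂ) + p.2 * Complex.I)) * C (ρ + p.2 * Complex.I)))) hint
  simp only [hinner] at hswap
  rw [← Measure.volume_eq_prod, ← hswap, ← integral_const_mul]
  refine setIntegral_congr_fun measurableSet_Ioi fun x hx => ?_
  rw [mem_Ioi] at hx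
  have hx' : (x : ℂ) ≠ 0 := by exact_mod_cast hx.ne'
  -- For fixed x, x^{-(s+t)} = x^{-s} x^{-t} is absorbed into X^{-s} and Y^{-t}, so the double
  -- integral factors.
  have hsplit : ∀ p : ℝ × ℝ,
      (α x * (x : ℂ) ^ (-(((σ : ℂ) + p.1 * Complex.I) + (ρ + p.2 * Complex.I)))) *
      (((X : ℂ) ^ (-((σ : ℂ) + p.1 * Complex.I)) * B (σ + p.1 * Complex.I)) *
      ((Y : ℂ) ^ (-((ρ : ℂ) + p.2 * Complex.I)) * C (ρ + p.2 * Complex.I))) =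
      α x * ((((X * x : ℝ) : ℂ) ^ (-((σ : ℂ) + p.1 * Complex.I)) • B (σ + p.1 * Complex.I)) *
      (((Y * x : ℝ) : ℂ) ^ (-((ρ : ℂ) + p.2 * Complex.I)) • C (ρ + p.2 * Complex.I))) := by
    intro p
    rw [Complex.ofReal_mul, Complex.mul_cpow_ofReal_nonneg hX.le hx.le, Complex.ofReal_mul,
      Complex.mul_cpow_ofReal_nonneg hY.le hx.le, neg_add, Complex.cpow_add _ _ hx']
    simp only [smul_eq_mul]
    ring
  simp only [hsplit]
  rw [integral_const_mul, Measure.volume_eq_prod, integral_prod_mul (μ := volume) (ν := volume)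
    (fun u : ℝ => ((X * x : ℝ) : ℂ) ^ (-((σ : ℂ) + u * Complex.I)) • B (σ + u * Complex.I))
    (fun v : ℝ => ((Y * x : ℝ) : ℂ) ^ (-((ρ : ℂ) + v * Complex.I)) • C (ρ + v * Complex.I))]
  simp only [mellinInv, Complex.real_smul]
  generalize (∫ u : ℝ, ((X * x : ℝ) : ℂ) ^ (-((σ : ℂ) + u * Complex.I)) • B (σ + u * Complex.I)) = b
  generalize (∫ v : ℝ, ((Y * x : ℝ) : ℂ) ^ (-((ρ : ℂ) + v * Complex.I)) • C (ρ + v * Complex.I)) = c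
  have : (Real.pi : ℂ) ≠ 0 := by exact_mod_cast Real.pi_ne_zero
  push_cast
  field_simp

/-! ### Mellin pairs: Beta, Gamma and the positive part of the logarithm -/

theorem integrableOn_cpow_mul_exp_neg_mul_Ioi {a : ℂ} {r : ℝ} (ha : 0 < a.re) (hr : 0 < r) :
    IntegrableOn (fun t : ℝ => (t : ℂ) ^ (a - 1) * Complex.exp (-(r * t))) (Ioi 0) := by
  have h := integrableOn_rpow_mul_exp_neg_mul_rpow (p := 1) (s := a.re - 1) (b := r)
    (by linarith) one_pos hr
  refine Integrable.mono' h ?_ ?_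
  · exact Measurable.aestronglyMeasurable (by fun_prop)
  · filter_upwards [ae_restrict_mem measurableSet_Ioi] with t ht
    rw [norm_mul, Complex.norm_cpow_eq_rpow_re_of_pos ht, Complex.norm_exp]
    simp

theorem integral_norm_cpow_mul_exp_neg_mul_Ioi {a : ℂ} {r : ℝ} (ha : 0 < a.re) (hr : 0 < r) :
    ∫ t in Ioi (0 : ℝ), ‖(t : ℂ) ^ (a - 1) * Complex.exp (-(r * t))‖ =
      (1 / r) ^ a.re * Real.Gamma a.re := by
  rw [← Real.integral_rpow_mul_exp_neg_mul_Ioi ha hr]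
  refine setIntegral_congr_fun measurableSet_Ioi fun t ht => ?_
  rw [norm_mul, Complex.norm_cpow_eq_rpow_re_of_pos ht, Complex.norm_exp]
  simp

/-- The Beta integral of the second kind. -/
theorem integral_cpow_mul_one_add_cpow {a b : ℂ} (ha : 0 < a.re) (hb : 0 < b.re) :
    IntegrableOn (fun x : ℝ => Complex.Gamma (a + b) * (x : ℂ) ^ (a - 1) *
      ((1 + x : ℝ) : ℂ) ^ (-(a + b))) (Ioi 0) ∧
    ∫ x in Ioi (0 : ℝ), Complex.Gamma (a + b) * (x : ℂ) ^ (a - 1) *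
      ((1 + x : ℝ) : ℂ) ^ (-(a + b)) = Complex.Gamma a * Complex.Gamma b := by
  have hab : 0 < (a + b).re := by simp; linarith
  -- Γ(a+b)(1+x)^{-(a+b)} is written as a Gamma integral over r. Integrating over x first then gives
  -- Γ(a) r^{-a}, and the remaining r-integral is Γ(b).
  have hx : ∀ x ∈ Ioi (0 : ℝ), ∫ r in Ioi (0 : ℝ), (x : ℂ) ^ (a - 1) *
      ((r : ℂ) ^ (a + b - 1) * Complex.exp (-(((1 + x : ℝ) : ℂ) * r))) =
      Complex.Gamma (a + b) * (x : ℂ) ^ (a - 1) * ((1 + x : ℝ) : ℂ) ^ (-(a + b)) := by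
    intro x hx
    rw [mem_Ioi] at hx
    rw [integral_const_mul, Complex.integral_cpow_mul_exp_neg_mul_Ioi hab (by linarith),
      one_div, ← Complex.ofReal_inv, ← Complex.ofReal_one]
    rw [Complex.ofReal_inv, Complex.inv_cpow, ← Complex.cpow_neg]
    · ring
    · rw [Complex.arg_ofReal_of_nonneg (by linarith)]
      exact Real.pi_pos.ne
  have hr : ∀ r ∈ Ioi (0 : ℝ), ∀ x ∈ Ioi (0 : ℝ), (x : ℂ) ^ (a - 1) *
      ((r : ℂ) ^ (a + b - 1) * Complex.exp (-(((1 + x : ℝ) : ℂ) * r))) =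
      ((r : ℂ) ^ (a + b - 1) * Complex.exp (-r)) * ((x : ℂ) ^ (a - 1) * Complex.exp (-(r * x))) := by
    intro r hr x hx
    have : -(((1 + x : ℝ) : ℂ) * r) = -r + -(r * x) := by push_cast; ring
    rw [this, Complex.exp_add]
    ring
  have hr' : ∀ r ∈ Ioi (0 : ℝ), ∫ x in Ioi (0 : ℝ), (x : ℂ) ^ (a - 1) *
      ((r : ℂ) ^ (a + b - 1) * Complex.exp (-(((1 + x : ℝ) : ℂ) * r))) =
      Complex.Gamma a * ((r : ℂ) ^ (b - 1) * Complex.exp (-((1 : ℝ) * r))) := by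
    intro r hr0
    have hr1 : (r : ℂ) ≠ 0 := by exact_mod_cast (ne_of_gt hr0)
    rw [setIntegral_congr_fun measurableSet_Ioi (hr r hr0), integral_const_mul,
      Complex.integral_cpow_mul_exp_neg_mul_Ioi ha hr0, one_div, Complex.inv_cpow,
      ← Complex.cpow_neg]
    · have : b - 1 = (a + b - 1) + -a := by ring
      rw [this, Complex.cpow_add _ _ hr1]
      simp
      ring
    · rw [Complex.arg_ofReal_of_nonneg (le_of_lt hr0)]
      exact Real.pi_pos.ne
  have hint : Integrable (fun p : ℝ × ℝ => (p.1 : ℂ) ^ (a - 1) *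
      ((p.2 : ℂ) ^ (a + b - 1) * Complex.exp (-(((1 + p.1 : ℝ) : ℂ) * p.2))))
      ((volume.restrict (Ioi 0)).prod (volume.restrict (Ioi 0))) := by
    rw [integrable_prod_iff' (Measurable.aestronglyMeasurable (by fun_prop))]
    constructor
    · filter_upwards [ae_restrict_mem measurableSet_Ioi] with r hr0
      refine IntegrableOn.congr_fun ?_ (fun x hx => (hr r hr0 x hx).symm) measurableSet_Ioi
      exact (integrableOn_cpow_mul_exp_neg_mul_Ioi ha hr0).const_mul _
    · have h := (integrableOn_cpow_mul_exp_neg_mul_Ioi hb one_pos).norm.const_mul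
        (Real.Gamma a.re)
      refine IntegrableOn.congr_fun h (fun r hr0 => ?_) measurableSet_Ioi
      have hr1 : (0 : ℝ) < r := hr0
      rw [setIntegral_congr_fun measurableSet_Ioi (fun x hx => congrArg norm (hr r hr0 x hx))]
      simp only [norm_mul _ ((_ : ℂ) ^ (a - 1) * _)]
      rw [integral_const_mul, integral_norm_cpow_mul_exp_neg_mul_Ioi ha hr0]
      simp only [norm_mul, Complex.norm_cpow_eq_rpow_re_of_pos hr1, Complex.norm_exp, one_div,
        Real.inv_rpow hr1.le, ← Real.rpow_neg hr1.le]
      have : (b - 1).re = (a + b - 1).re + -a.re := by simp; ring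
      rw [this, Real.rpow_add hr1]
      simp
      ring
  constructor
  · exact IntegrableOn.congr_fun hint.integral_prod_left hx measurableSet_Ioi
  · rw [← setIntegral_congr_fun measurableSet_Ioi hx]
    have hs := integral_integral_swap (μ := volume.restrict (Ioi (0 : ℝ)))
      (ν := volume.restrict (Ioi (0 : ℝ))) (f := fun x r : ℝ => (x : ℂ) ^ (a - 1) *
      ((r : ℂ) ^ (a + b - 1) * Complex.exp (-(((1 + x : ℝ) : ℂ) * r)))) hint
    rw [hs, setIntegral_congr_fun measurableSet_Ioi hr', integral_const_mul,
      Complex.integral_cpow_mul_exp_neg_mul_Ioi hb one_pos]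
    simp

theorem norm_Gamma_le {s : ℂ} (hs : 0 < s.re) : ‖Complex.Gamma s‖ ≤ Real.Gamma s.re := by
  have h := Complex.integral_cpow_mul_exp_neg_mul_Ioi hs one_pos
  have h' := integral_norm_cpow_mul_exp_neg_mul_Ioi hs one_pos
  simp only [Complex.ofReal_one, div_one, Complex.one_cpow, one_mul, Real.one_rpow] at h h'
  rw [← h, ← h']
  exact norm_integral_le_integral_norm _

theorem continuous_Gamma_comp {f : ℝ → ℂ} (hf : Continuous f) (hpos : ∀ u, 0 < (f u).re) :
    Continuous fun u => Complex.Gamma (f u) := by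
  rw [continuous_iff_continuousAt]
  intro u
  refine ContinuousAt.comp (g := Complex.Gamma) ?_ hf.continuousAt
  refine (Complex.differentiableAt_Gamma _ fun n hn => ?_).continuousAt
  have := hpos u
  rw [hn] at this
  simp at this
  linarith [(Nat.cast_nonneg n : (0 : ℝ) ≤ n)]

theorem norm_sq_add_mul_I (c u : ℝ) : ‖(c : ℂ) + u * Complex.I‖ ^ 2 = c ^ 2 + u ^ 2 := by
  rw [Complex.sq_norm, Complex.normSq_add_mul_I]

theorem add_mul_I_ne_zero {c : ℝ} (hc : c ≠ 0) (u : ℝ) : (c : ℂ) + u * Complex.I ≠ 0 := by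
  intro h
  have := congrArg Complex.re h
  simp at this
  exact hc this

theorem integrable_inv_sq_add_sq {c : ℝ} (hc : c ≠ 0) :
    Integrable fun u : ℝ => (c ^ 2 + u ^ 2)⁻¹ := by
  have h := (integrable_inv_one_add_sq.comp_div hc).const_mul (c ^ 2)⁻¹
  refine h.congr (Filter.Eventually.of_forall fun u => ?_)
  simp only
  rw [← mul_inv]
  congr 1
  field_simp

theorem verticalIntegrable_inv_sq {σ : ℝ} (hσ : σ ≠ 0) :
    Complex.VerticalIntegrable (fun s => 1 / s ^ 2) σ := by
  refine Integrable.mono' (integrable_inv_sq_add_sq hσ) ?_ (Filter.Eventually.of_forall fun u => ?_)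
  · exact Measurable.aestronglyMeasurable (by fun_prop)
  · rw [norm_div, norm_pow, norm_sq_add_mul_I]
    simp

/-- Two steps of the functional equation, Γ(t+2) = (t+1) t Γ(t), with |Γ(t+2)| ≤ Γ(ρ+2) and |t| ≤
|t+1|, give quadratic decay. This suffices; the exponential decay is not needed. -/
theorem verticalIntegrable_Gamma {ρ : ℝ} (hρ : 0 < ρ) :
    Complex.VerticalIntegrable Complex.Gamma ρ := by
  refine Integrable.mono' ((integrable_inv_sq_add_sq hρ.ne').const_mul (Real.Gamma (ρ + 2)))
    (continuous_Gamma_comp (by fun_prop) (by simpa using hρ)).aestronglyMeasurable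
    (Filter.Eventually.of_forall fun u => ?_)
  set t : ℂ := (ρ : ℂ) + u * Complex.I with ht
  have hre : t.re = ρ := by simp [ht]
  have ht0 : t ≠ 0 := add_mul_I_ne_zero hρ.ne' u
  have ht1 : t + 1 ≠ 0 := by
    intro h
    have := congrArg Complex.re h
    simp [hre] at this
    linarith
  have hG : Complex.Gamma (t + 2) = (t + 1) * (t * Complex.Gamma t) := by
    rw [← Complex.Gamma_add_one t ht0, ← Complex.Gamma_add_one _ ht1]
    congr 1
    ring
  have hb := norm_Gamma_le (s := t + 2) (by simp [hre]; linarith)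
  rw [hG, norm_mul, norm_mul] at hb
  have hre2 : (t + 2).re = ρ + 2 := by simp [hre]
  rw [hre2] at hb
  have hle : ‖t‖ ≤ ‖t + 1‖ := by
    rw [← sq_le_sq₀ (norm_nonneg _) (norm_nonneg _), Complex.sq_norm, Complex.sq_norm,
      Complex.normSq_apply, Complex.normSq_apply]
    simp [hre]
    nlinarith
  have hpos : 0 < ‖t‖ := norm_pos_iff.mpr ht0
  rw [← norm_sq_add_mul_I, ← ht, ← div_eq_mul_inv, le_div_iff₀ (by positivity)]
  calc ‖Complex.Gamma t‖ * ‖t‖ ^ 2 = ‖t‖ * (‖t‖ * ‖Complex.Gamma t‖) := by ring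
    _ ≤ ‖t + 1‖ * (‖t‖ * ‖Complex.Gamma t‖) := by gcongr
    _ ≤ _ := hb

theorem mellinInv_Gamma {ρ x : ℝ} (hρ : 0 < ρ) (hx : 0 < x) :
    mellinInv ρ Complex.Gamma x = Real.exp (-x) := by
  -- Mellin inversion only sees the transform on the line, so agreement there is enough.
  have hline : ∀ y : ℝ, mellin (fun x : ℝ => ((Real.exp (-x) : ℝ) : ℂ)) (ρ + y * Complex.I) =
      Complex.Gamma (ρ + y * Complex.I) := by
    intro y
    rw [← Complex.GammaIntegral_eq_mellin, Complex.Gamma_eq_integral (by simpa using hρ)]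
  have h := mellinInv_mellin_eq ρ (fun x : ℝ => ((Real.exp (-x) : ℝ) : ℂ)) hx ?_ ?_ ?_
  · rw [← h]
    simp only [mellinInv, hline]
  · have := integrableOn_cpow_mul_exp_neg_mul_Ioi (a := ρ) (r := 1) (by simpa using hρ) one_pos
    simpa [MellinConvergent] using this
  · have := verticalIntegrable_Gamma hρ
    simp only [Complex.VerticalIntegrable, hline] at this ⊢
    exact this
  · fun_prop

open Filter Asymptotics Topology in
theorem mellinConvergent_posLog {s : ℂ} (hs : s.re < 0) :
    MellinConvergent (fun x => (Real.posLog x : ℂ)) s := by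
  -- At infinity log x = O(x^{-a}) for any a < 0, and a = Re s / 2 still exceeds Re s. Near 0 the
  -- function vanishes, so any b < Re s would do.
  refine mellinConvergent_of_isBigO_rpow (a := s.re / 2) (b := s.re - 1) ?_ ?_ (by linarith) ?_
    (by linarith)
  · refine ContinuousOn.locallyIntegrableOn ?_ measurableSet_Ioi
    exact (Complex.continuous_ofReal.comp Real.continuous_posLog).continuousOn
  · have h := (isLittleO_log_rpow_atTop (r := -(s.re / 2)) (by linarith)).isBigO
    refine IsBigO.congr' (f₁ := fun x => ((Real.log x : ℝ) : ℂ)) ?_ ?_ EventuallyEq.rfl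
    · exact (IsBigO.of_norm_left (by simpa only [Complex.norm_real] using h.norm_left))
    · filter_upwards [eventually_ge_atTop 1] with x hx
      rw [Real.posLog_eq_log (by rwa [abs_of_nonneg (by linarith)])]
  · refine IsBigO.congr' (f₁ := fun x => (0 : ℂ)) (isBigO_zero _ _) ?_ EventuallyEq.rfl
    filter_upwards [Ioo_mem_nhdsGT (show (0 : ℝ) < 1 by norm_num)] with x hx
    rw [eq_comm, Complex.ofReal_eq_zero, Real.posLog_eq_zero_iff, abs_of_pos hx.1]
    exact hx.2.le

-- The integrand lives on (1, ∞), where x^s (log x / s - 1/s²) is a primitive that tends to 0 at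
-- infinity and equals -1/s² at 1.
open Filter Asymptotics Topology in
theorem mellin_posLog {s : ℂ} (hs : s.re < 0) :
    mellin (fun x => (Real.posLog x : ℂ)) s = 1 / s ^ 2 := by
  have hs0 : s ≠ 0 := by rintro rfl; simp at hs
  have hconv := mellinConvergent_posLog hs
  have hsub : ∀ x ∈ Ioi (0 : ℝ) \ Ioi 1, (x : ℂ) ^ (s - 1) • (Real.posLog x : ℂ) = 0 := by
    rintro x ⟨hx0, hx1⟩
    rw [mem_Ioi] at hx0
    rw [(Real.posLog_eq_zero_iff x).mpr (by rw [abs_of_pos hx0]; simpa using hx1)]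
    simp
  have hlog : ∀ x ∈ Ioi (1 : ℝ), (x : ℂ) ^ (s - 1) • (Real.posLog x : ℂ) =
      (x : ℂ) ^ (s - 1) * (Real.log x : ℂ) := by
    intro x hx
    rw [mem_Ioi] at hx
    rw [Real.posLog_eq_log (by rw [abs_of_pos (by linarith)]; exact hx.le), smul_eq_mul]
  rw [mellin, setIntegral_eq_of_subset_of_forall_sdiff_eq_zero measurableSet_Ioi
    (Ioi_subset_Ioi zero_le_one) hsub, setIntegral_congr_fun measurableSet_Ioi hlog]
  have hint : IntegrableOn (fun x : ℝ => (x : ℂ) ^ (s - 1) * (Real.log x : ℂ)) (Ioi 1) :=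
    (hconv.mono_set (Ioi_subset_Ioi zero_le_one)).congr_fun hlog measurableSet_Ioi
  have hderiv : ∀ x ∈ Ici (1 : ℝ), HasDerivAt
      (fun x : ℝ => (x : ℂ) ^ s * ((Real.log x : ℂ) / s - 1 / s ^ 2))
      ((x : ℂ) ^ (s - 1) * (Real.log x : ℂ)) x := by
    intro x hx
    rw [mem_Ici] at hx
    have hx0 : x ≠ 0 := by linarith
    have hxc : (x : ℂ) ≠ 0 := by exact_mod_cast hx0
    have h1 := hasDerivAt_ofReal_cpow_const' (r := s - 1) hx0 (by
      intro h; apply hs0; linear_combination h)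
    have h2 := ((Real.hasDerivAt_log hx0).ofReal_comp.div_const s).sub_const (1 / s ^ 2)
    have h3 := (h1.mul_const s).mul h2
    have hsx : (x : ℂ) ^ s = (x : ℂ) ^ (s - 1) * x := by
      nth_rewrite 3 [← Complex.cpow_one (x : ℂ)]
      rw [← Complex.cpow_add _ _ hxc, sub_add_cancel]
    refine (h3.congr_deriv ?_).congr_of_eventuallyEq (Eventually.of_forall fun y => ?_)
    · simp only [sub_add_cancel]
      rw [hsx]
      push_cast
      field_simp
      ring
    · simp only [sub_add_cancel, Pi.mul_apply]
      field_simp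
  have hlim : Tendsto (fun x : ℝ => (x : ℂ) ^ s * ((Real.log x : ℂ) / s - 1 / s ^ 2)) atTop (𝓝 0) := by
    have h1 : Tendsto (fun x : ℝ => (x : ℂ) ^ s) atTop (𝓝 0) := by
      rw [tendsto_zero_iff_norm_tendsto_zero]
      refine (tendsto_rpow_neg_atTop (y := -s.re) (by linarith)).congr' ?_
      filter_upwards [eventually_gt_atTop 0] with x hx
      rw [Complex.norm_cpow_eq_rpow_re_of_pos hx, neg_neg]
    have h2 : Tendsto (fun x : ℝ => (x : ℂ) ^ s * (Real.log x : ℂ)) atTop (𝓝 0) := by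
      rw [tendsto_zero_iff_norm_tendsto_zero]
      have h := ((isLittleO_log_rpow_atTop (r := -s.re) (by linarith)).tendsto_div_nhds_zero).norm
      rw [norm_zero] at h
      refine h.congr' ?_
      filter_upwards [eventually_gt_atTop 0] with x hx
      rw [norm_mul, Complex.norm_cpow_eq_rpow_re_of_pos hx, Complex.norm_real, norm_div,
        Real.norm_of_nonneg (Real.rpow_nonneg hx.le (-s.re)), Real.rpow_neg hx.le]
      field_simp
    have h := (h2.div_const s).sub (h1.mul_const (1 / s ^ 2))
    simp only [zero_div, zero_mul, sub_zero] at h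
    refine h.congr fun x => ?_
    ring
  rw [integral_Ioi_of_hasDerivAt_of_tendsto' hderiv hint hlim]
  simp

theorem mellinInv_inv_sq {σ x : ℝ} (hσ : σ < 0) (hx : 0 < x) :
    mellinInv σ (fun s : ℂ => 1 / s ^ 2) x = (Real.posLog x : ℂ) := by
  have hline : ∀ y : ℝ, mellin (fun x => (Real.posLog x : ℂ)) (σ + y * Complex.I) =
      1 / (σ + y * Complex.I) ^ 2 := fun y => mellin_posLog (by simpa using hσ)
  rw [← mellinInv_mellin_eq σ (fun x => (Real.posLog x : ℂ)) hx
    (mellinConvergent_posLog (by simpa using hσ))]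
  · simp only [mellinInv, hline]
  · have := verticalIntegrable_inv_sq hσ.ne
    simp only [Complex.VerticalIntegrable, hline] at this ⊢
    exact this
  · exact (Complex.continuous_ofReal.comp Real.continuous_posLog).continuousAt

theorem verticalIntegrable_Gamma_mul_inv_sq {σ : ℝ} (hσ : σ < 0) (i : ℕ) :
    Complex.VerticalIntegrable (fun s => Complex.Gamma (1 + i - s) * (1 / s ^ 2)) σ := by
  have hre : ∀ u : ℝ, (1 + (i : ℂ) - (σ + u * Complex.I)).re = 1 + i - σ := by intro u; simp
  have hpos : 0 < 1 + (i : ℝ) - σ := by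
    have : (0 : ℝ) ≤ i := i.cast_nonneg
    linarith
  refine Integrable.bdd_mul (c := Real.Gamma (1 + i - σ)) (verticalIntegrable_inv_sq hσ.ne) ?_ ?_
  · exact (continuous_Gamma_comp (by fun_prop) (fun u => by rw [hre]; exact hpos)).aestronglyMeasurable
  · refine Filter.Eventually.of_forall fun u => ?_
    have := norm_Gamma_le (s := 1 + (i : ℂ) - (σ + u * Complex.I)) (by rw [hre]; exact hpos)
    rwa [hre] at this

/-- Γ(1+i-s) = ∫ v^i e^{-v} v^{-s} dv is pulled out of the inverse transform, leaving the transform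
of 1/s² at zv. -/
theorem mellinInv_Gamma_mul_inv_sq {σ z : ℝ} (hσ : σ < 0) (hz : 0 < z) (i : ℕ) :
    mellinInv σ (fun s => Complex.Gamma (1 + i - s) * (1 / s ^ 2)) z =
      ((∫ v in Ioi (0 : ℝ), v ^ i * Real.exp (-v) * Real.posLog (z * v) : ℝ) : ℂ) := by
  have hcpow : ∀ s : ℂ, ∀ v ∈ Ioi (0 : ℝ), (v : ℂ) ^ ((1 + i - s) - 1) *
      Complex.exp (-((1 : ℝ) * v)) = ((v ^ i * Real.exp (-v) : ℝ) : ℂ) * (v : ℂ) ^ (-s) := by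
    intro s v hv
    have hv0 : (v : ℂ) ≠ 0 := by exact_mod_cast (ne_of_gt hv)
    have : (1 + i - s) - 1 = i + -s := by ring
    rw [this, Complex.cpow_add _ _ hv0, Complex.cpow_natCast]
    push_cast
    rw [one_mul]
    ring
  have hi : (0 : ℝ) ≤ i := i.cast_nonneg
  rw [mellinInv_mul_eq_integral (α := fun v : ℝ => ((v ^ i * Real.exp (-v) : ℝ) : ℂ)) hz ?_ ?_
    (verticalIntegrable_inv_sq hσ.ne), ← integral_complex_ofReal]
  · refine setIntegral_congr_fun measurableSet_Ioi fun v hv => ?_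
    rw [mem_Ioi] at hv
    rw [mellinInv_inv_sq hσ (by positivity)]
    push_cast
    rfl
  · exact (integrableOn_cpow_mul_exp_neg_mul_Ioi (a := 1 + i - σ) (by simp; linarith)
      one_pos).congr_fun (hcpow σ) measurableSet_Ioi
  · intro s hs
    rw [← setIntegral_congr_fun measurableSet_Ioi (hcpow s),
      Complex.integral_cpow_mul_exp_neg_mul_Ioi (by simp [hs]; linarith) one_pos]
    simp

/-! ### Evaluation of the EGBMG -/

/-- The value of the `i`-th EGBMG of the capacity series, as an iterated real integral. -/
noncomputable def opraRealIntegral (m X Y : ℝ) (i : ℕ) : ℝ :=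
  Real.Gamma (m + i) * ∫ x in Ioi (0 : ℝ), x ^ m * (1 + x) ^ (-(m + i)) *
    (∫ v in Ioi (0 : ℝ), v ^ i * Real.exp (-v) * Real.posLog (X * x * v)) * Real.exp (-(Y * x))

theorem separatingContours_opra_iff (m : ℝ) (i : ℕ) (σ ρ : ℝ) :
    SeparatingContours (opraBlock₁ m i) (opraBlock₂ i) opraBlock₃ σ ρ ↔
      (0 < i - 1 + (σ + ρ) ∧ 0 < 1 + m - (σ + ρ)) ∧ (0 < 1 + i - σ ∧ σ < 0) ∧ 0 < ρ := by
  simp [SeparatingContours, MeijerBlock.Separates, opraBlock₁, opraBlock₂, opraBlock₃]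

theorem egbmgIntegrand_opra (m : ℝ) (i : ℕ) (x y : ℂ) {s t : ℂ} (hs : s.re < 0) :
    egbmgIntegrand (opraBlock₁ m i) (opraBlock₂ i) opraBlock₃ x y s t =
      (Complex.Gamma (1 + m - (s + t)) * Complex.Gamma (i - 1 + (s + t))) *
        (Complex.Gamma (1 + i - s) * (1 / s ^ 2)) * Complex.Gamma t * x ^ (-s) * y ^ (-t) := by
  have hs0 : s ≠ 0 := by rintro rfl; simp at hs
  have hΓ : Complex.Gamma (-s) ≠ 0 := Complex.Gamma_ne_zero_of_re_pos (by simpa using hs)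
  have hΓ1 : Complex.Gamma (1 - s) = -s * Complex.Gamma (-s) := by
    rw [← Complex.Gamma_add_one _ (neg_ne_zero.mpr hs0)]
    congr 1
    ring
  simp only [egbmgIntegrand, MeijerBlock.psi, opraBlock₁, opraBlock₂, opraBlock₃]
  simp [hΓ1]
  field_simp
  simp

theorem hasEGBMG_opra {m X Y : ℝ} (hm : 0 < m) (hX : 0 < X) (hY : 0 < Y) (i : ℕ) :
    HasEGBMG (opraBlock₁ m i) (opraBlock₂ i) opraBlock₃ (X : ℂ) (Y : ℂ)
      (opraRealIntegral m X Y i : ℂ) := by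
  -- Here σ + ρ = 1 + m/2 is the midpoint of the strip (1, m+1) for i = 0, which lies in the strip
  -- for every i.
  refine ⟨⟨-1, 2 + m / 2, ?_⟩, fun σ ρ h => ?_⟩
  · rw [separatingContours_opra_iff]
    have hi : (0 : ℝ) ≤ i := i.cast_nonneg
    refine ⟨⟨?_, ?_⟩, ⟨?_, ?_⟩, ?_⟩ <;> linarith
  rw [separatingContours_opra_iff] at h
  obtain ⟨⟨h1, h2⟩, ⟨-, hσ⟩, hρ⟩ := h
  set α : ℝ → ℂ := fun x => ((Real.Gamma (m + i) * (x ^ m * (1 + x) ^ (-(m + i))) : ℝ) : ℂ) with hαdef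
  -- The Beta integral with a = 1+m-w and b = i-1+w: the sum a+b = m+i does not depend on w, so w
  -- enters only through x^{-w}.
  have hcpow : ∀ w : ℂ, ∀ x ∈ Ioi (0 : ℝ),
      Complex.Gamma ((1 + m - w) + (i - 1 + w)) * (x : ℂ) ^ ((1 + m - w) - 1) *
        ((1 + x : ℝ) : ℂ) ^ (-((1 + m - w) + (i - 1 + w))) = α x * (x : ℂ) ^ (-w) := by
    intro w x hx
    rw [mem_Ioi] at hx
    have hx0 : (x : ℂ) ≠ 0 := by exact_mod_cast hx.ne'
    have e1 : (1 + m - w) + (i - 1 + w) = ((m + i : ℝ) : ℂ) := by push_cast; ring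
    have e2 : (1 + m - w) - 1 = (m : ℂ) + -w := by ring
    rw [e1, e2, Complex.cpow_add _ _ hx0, Complex.Gamma_ofReal, ← Complex.ofReal_neg,
      ← Complex.ofReal_cpow hx.le, ← Complex.ofReal_cpow (by linarith), hαdef]
    push_cast
    ring
  have hα : IntegrableOn (fun x : ℝ => α x * (x : ℂ) ^ (-((σ + ρ : ℝ) : ℂ))) (Ioi 0) :=
    (integral_cpow_mul_one_add_cpow (a := 1 + m - (σ + ρ : ℝ)) (b := i - 1 + (σ + ρ : ℝ))
      (by simpa using h2) (by simpa using h1)).1.congr_fun (hcpow _) measurableSet_Ioi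
  have hA : ∀ w : ℂ, w.re = σ + ρ → ∫ x in Ioi (0 : ℝ), α x * (x : ℂ) ^ (-w) =
      Complex.Gamma (1 + m - w) * Complex.Gamma (i - 1 + w) := by
    intro w hw
    rw [← setIntegral_congr_fun measurableSet_Ioi (hcpow w)]
    exact (integral_cpow_mul_one_add_cpow (by simpa [hw] using h2) (by simpa [hw] using h1)).2
  obtain ⟨hint, hval⟩ := integral_mellinBarnes_eq hX hY hα hA
    (verticalIntegrable_Gamma_mul_inv_sq hσ i) (verticalIntegrable_Gamma hρ)
  have hline : ∀ c u : ℝ, verticalLine c u = c + u * Complex.I := fun c u => by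
    rw [verticalLine, mul_comm]
  have hintegrand : ∀ u v : ℝ, egbmgIntegrand (opraBlock₁ m i) (opraBlock₂ i) opraBlock₃ X Y
      (verticalLine σ u) (verticalLine ρ v) = _ := fun u v => by
    rw [hline, hline, egbmgIntegrand_opra m i _ _ (by simpa using hσ)]
  constructor
  · simp only [hintegrand]
    exact hint
  -- The -1 from ds dt cancels the sign of (2πj)², and the (2π)² of the two inverse transforms
  -- cancels the rest.
  · simp only [doubleMellinBarnes, hintegrand, mul_assoc _ Complex.I Complex.I, Complex.I_mul_I,
      integral_mul_const]
    rw [hval]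
    have hreal : ∀ x ∈ Ioi (0 : ℝ), α x *
        mellinInv σ (fun s => Complex.Gamma (1 + i - s) * (1 / s ^ 2)) (X * x) *
        mellinInv ρ Complex.Gamma (Y * x) =
        ((Real.Gamma (m + i) * (x ^ m * (1 + x) ^ (-(m + i)) *
          (∫ v in Ioi (0 : ℝ), v ^ i * Real.exp (-v) * Real.posLog (X * x * v)) *
          Real.exp (-(Y * x))) : ℝ) : ℂ) := by
      intro x hx
      rw [mem_Ioi] at hx
      rw [mellinInv_Gamma_mul_inv_sq hσ (by positivity), mellinInv_Gamma hρ (by positivity), hαdef]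
      push_cast
      ring
    rw [setIntegral_congr_fun measurableSet_Ioi hreal, integral_complex_ofReal, integral_const_mul,
      ← opraRealIntegral]
    have : (Real.pi : ℂ) ≠ 0 := by exact_mod_cast Real.pi_ne_zero
    field_simp
    simp

/-- The value is unique because a separating pair of contours exists: the chosen value and G both
equal the integral along it. -/
theorem HasEGBMG.egbmg_eq {B₁ B₂ B₃ : MeijerBlock} {x y G : ℂ} (h : HasEGBMG B₁ B₂ B₃ x y G) :
    egbmg B₁ B₂ B₃ x y = G := by
  have hex : ∃ G, HasEGBMG B₁ B₂ B₃ x y G := ⟨G, h⟩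
  obtain ⟨σ, ρ, hc⟩ := h.1
  rw [egbmg, dif_pos hex, ← (hex.choose_spec.2 σ ρ hc).2, (h.2 σ ρ hc).2]

/-! ### Series expansion of the joint density -/

theorem hasSum_ascPochhammer_div_factorial (a : ℝ) {y : ℝ} (hy0 : 0 ≤ y) (hy : y < 1) :
    HasSum (fun n : ℕ => (ascPochhammer ℝ n).eval a / n.factorial * y ^ n) ((1 - y) ^ (-a)) := by
  have h := (Real.one_div_one_sub_rpow_hasFPowerSeriesOnBall_zero a).hasSum (y := y) (by
    rw [Metric.mem_eball, edist_zero_right, Real.enorm_of_nonneg hy0]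
    simpa using hy)
  rw [zero_add, one_div, ← Real.rpow_neg (by linarith)] at h
  refine h.congr_fun fun n => ?_
  rw [FormalMultilinearSeries.ofScalars_apply_eq, smul_eq_mul, Ring.choose]
  congr 1
  have e : a + n - 1 - n + 1 = a := by ring
  have hf := Ring.factorial_nsmul_multichoose_eq_ascPochhammer a n
  rw [e, div_eq_iff (by positivity), mul_comm, ← nsmul_eq_mul, hf,
    ← Polynomial.eval₂_smulOneHom_eq_smeval, ← ascPochhammer_eval₂]

/-- Absorbs the factor n+1 that the bound on the logarithm costs, at the price of raising the
binomial exponent from m to m+1. It follows from m (m+1)_n = (m+n) (m)_n. -/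
theorem ascPochhammer_mul_succ_le {m : ℝ} (hm : 0 < m) (n : ℕ) :
    (ascPochhammer ℝ n).eval m * (n + 1) ≤ max m 1 * (ascPochhammer ℝ n).eval (m + 1) := by
  have h1 : (ascPochhammer ℝ n).eval (m + 1) * m = (ascPochhammer ℝ n).eval m * (m + n) := by
    have e1 := ascPochhammer_succ_eval (S := ℝ) n m
    have e2 : (ascPochhammer ℝ (n + 1)).eval m = m * (ascPochhammer ℝ n).eval (m + 1) := by
      rw [ascPochhammer_succ_left]
      simp
    linarith
  have hpos : 0 < (ascPochhammer ℝ n).eval m := ascPochhammer_pos n m hm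
  have hk : (n + 1) * m ≤ max m 1 * (m + n) := by
    have a1 := le_max_left m 1
    have a2 := le_max_right m 1
    have hn : (0 : ℝ) ≤ n := n.cast_nonneg
    nlinarith
  refine le_of_mul_le_mul_right ?_ hm
  calc _ = (ascPochhammer ℝ n).eval m * ((n + 1) * m) := by ring
    _ ≤ (ascPochhammer ℝ n).eval m * (max m 1 * (m + n)) := by gcongr
    _ = _ := by rw [mul_assoc, h1]; ring

theorem ascPochhammer_eval_div_Gamma {m : ℝ} (hm : 0 < m) (n : ℕ) :
    (ascPochhammer ℝ n).eval m / Real.Gamma (m + n) = 1 / Real.Gamma m := by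
  have h : Real.Gamma (m + n) = (ascPochhammer ℝ n).eval m * Real.Gamma m := by
    induction n with
    | zero => simp
    | succ n ih =>
      have : m + (n + 1 : ℕ) = m + n + 1 := by push_cast; ring
      rw [this, Real.Gamma_add_one (by positivity), ih, ascPochhammer_succ_eval]
      ring
  have hpos : 0 < (ascPochhammer ℝ n).eval m := ascPochhammer_pos n m hm
  rw [h, div_mul_eq_div_div, div_self hpos.ne']

theorem lintegral_pow_mul_exp_neg {b : ℝ} (hb : 0 < b) (n : ℕ) :
    ∫⁻ γ in Ioi (0 : ℝ), ENNReal.ofReal (b * (b * γ) ^ n * Real.exp (-(b * γ))) =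
      ENNReal.ofReal n.factorial := by
  have hcongr : ∀ γ ∈ Ioi (0 : ℝ), b ^ (n + 1) * (γ ^ (((n : ℝ) + 1) - 1) * Real.exp (-(b * γ))) =
      b * (b * γ) ^ n * Real.exp (-(b * γ)) := by
    intro γ _
    rw [add_sub_cancel_right, Real.rpow_natCast]
    ring
  have hpos : (0 : ℝ) < n + 1 := by positivity
  have hint : IntegrableOn (fun γ : ℝ => b * (b * γ) ^ n * Real.exp (-(b * γ))) (Ioi 0) := by
    have h := (integrableOn_rpow_mul_exp_neg_mul_rpow (p := 1) (s := (n + 1 : ℝ) - 1) (b := b)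
      (by linarith) one_pos hb).const_mul (b ^ (n + 1))
    simp only [Real.rpow_one, neg_mul] at h
    exact IntegrableOn.congr_fun h hcongr measurableSet_Ioi
  rw [← ofReal_integral_eq_lintegral_ofReal hint]
  · rw [← setIntegral_congr_fun measurableSet_Ioi hcongr, integral_const_mul,
      Real.integral_rpow_mul_exp_neg_mul_Ioi hpos hb, Real.Gamma_nat_eq_factorial]
    have : (1 / b) ^ ((n : ℝ) + 1) = (1 / b) ^ (n + 1) := by
      rw [← Real.rpow_natCast]; push_cast; rfl
    rw [this]
    congr 1
    field_simp
    rw [← mul_pow, mul_one_div_cancel hb.ne', one_pow]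
  · filter_upwards [ae_restrict_mem measurableSet_Ioi] with γ hγ
    rw [mem_Ioi] at hγ
    simp only [Pi.zero_apply]
    positivity

/-- The weight `(x / Y) ^ m (1 + x / Y) ^ (-(m + n))` with `Y = k / m`. -/
noncomputable def fdWeight (m k : ℝ) (n : ℕ) (x : ℝ) : ℝ :=
  (m * x / k) ^ m * (1 + m * x / k) ^ (-(m + n))

/-- The `n`-th term of the expansion of the joint density of the SNR `γ` and of `x`. -/
noncomputable def fdJointTerm (m k γbar : ℝ) (n : ℕ) (γ x : ℝ) : ℝ :=
  (ascPochhammer ℝ n).eval m / (n.factorial : ℝ) ^ 2 * fdWeight m k n x *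
    ((k + 1) / γbar / x * ((k + 1) / γbar / x * γ) ^ n * Real.exp (-((k + 1) / γbar / x * γ))) *
      Real.exp (-x)

/-- The exponential rate (1+k_x)/γbar_x simplifies to b = (k+1)/(γbar x), and the argument of ₁F₁ to
bγ/(1+mx/k). The second factor n! in the denominator is (1)_n. -/
theorem fdRLoSCondPDF_mul_exp_eq_tsum {m k γbar x : ℝ} (hm : 0 < m) (hk : 0 < k) (hγbar : 0 < γbar)
    (hx : 0 < x) (γ : ℝ) :
    fdRLoSCondPDF m k γbar x γ * Real.exp (-x) = ∑' n : ℕ, fdJointTerm m k γbar n γ x := by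
  simp only [fdRLoSCondPDF, confluentHypergeometric]
  rw [← tsum_mul_left, ← tsum_mul_right]
  refine tsum_congr fun n => ?_
  have e1 : (1 + k / x) / ((k + x) / (k + 1) * γbar) = (k + 1) / γbar / x := by field_simp; ring
  have e2 : k / x * (1 + k / x) / (k / x + m) * (γ / ((k + x) / (k + 1) * γbar)) =
      (1 + m * x / k)⁻¹ * ((k + 1) / γbar / x * γ) := by
    rw [← e1]
    field_simp
  have e3 : m ^ m * (1 + k / x) / ((m + k / x) ^ m * ((k + x) / (k + 1) * γbar)) =
      (m * x / k) ^ m * (1 + m * x / k) ^ (-m) * ((k + 1) / γbar / x) := by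
    rw [mul_div_mul_comm, e1, ← Real.div_rpow hm.le (by positivity), Real.rpow_neg (by positivity),
      ← div_eq_mul_inv, ← Real.div_rpow (by positivity) (by positivity)]
    congr 2
    field_simp
    ring
  have e4 : (1 + m * x / k) ^ (-(m + n)) = (1 + m * x / k) ^ (-m) * ((1 + m * x / k)⁻¹) ^ n := by
    rw [neg_add, Real.rpow_add (by positivity), Real.rpow_neg _ (n : ℝ), Real.rpow_natCast, inv_pow]
    positivity
  rw [e1, e2, e3, fdJointTerm, fdWeight, e4, ascPochhammer_eval_one, mul_pow]
  ring

theorem fdWeight_nonneg {m k x : ℝ} (hm : 0 < m) (hk : 0 < k) (hx : 0 < x) (n : ℕ) :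
    0 ≤ fdWeight m k n x := by
  rw [fdWeight]; positivity

theorem fdJointTerm_nonneg {m k γbar γ x : ℝ} (hm : 0 < m) (hk : 0 < k) (hγbar : 0 < γbar)
    (hγ : 0 < γ) (hx : 0 < x) (n : ℕ) : 0 ≤ fdJointTerm m k γbar n γ x := by
  have h1 := fdWeight_nonneg hm hk hx n
  have h2 : 0 < (ascPochhammer ℝ n).eval m := ascPochhammer_pos n m hm
  rw [fdJointTerm]
  positivity

/-! ### Absolute convergence -/

/-- The `n`-th term of the expansion of the integrand of the capacity. -/
noncomputable def opraTerm (m k γbar γ₀ : ℝ) (n : ℕ) (p : ℝ × ℝ) : ℝ :=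
  Real.logb 2 (p.1 / γ₀) * fdJointTerm m k γbar n p.1 p.2

theorem measurable_opraTerm (m k γbar γ₀ : ℝ) (n : ℕ) : Measurable (opraTerm m k γbar γ₀ n) := by
  unfold opraTerm fdJointTerm fdWeight Real.logb
  fun_prop

theorem opraTerm_nonneg {m k γbar γ₀ γ x : ℝ} (hm : 0 < m) (hk : 0 < k) (hγbar : 0 < γbar)
    (hγ₀ : 0 < γ₀) (hγ : γ₀ < γ) (hx : 0 < x) (n : ℕ) : 0 ≤ opraTerm m k γbar γ₀ n (γ, x) := by
  refine mul_nonneg (Real.logb_nonneg (by norm_num) ?_)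
    (fdJointTerm_nonneg hm hk hγbar (hγ₀.trans hγ) hx n)
  rw [le_div_iff₀ hγ₀]
  linarith

/-- Since log u ≤ u, the logarithm costs one more power of γ, so the Gamma integral gives (n+1)! and
a factor 1/b proportional to x. -/
theorem lintegral_opraTerm_le {m k γbar γ₀ x : ℝ} (hm : 0 < m) (hk : 0 < k) (hγbar : 0 < γbar)
    (hγ₀ : 0 < γ₀) (hx : 0 < x) (n : ℕ) :
    ∫⁻ γ in Ioi γ₀, ENNReal.ofReal (opraTerm m k γbar γ₀ n (γ, x)) ≤
      ENNReal.ofReal ((ascPochhammer ℝ n).eval m / (n.factorial : ℝ) ^ 2 * fdWeight m k n x *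
        Real.exp (-x) * (x * γbar / ((k + 1) * γ₀ * Real.log 2)) * (n + 1).factorial) := by
  have hw := fdWeight_nonneg hm hk hx n
  have hp : 0 < (ascPochhammer ℝ n).eval m := ascPochhammer_pos n m hm
  have hl : 0 < Real.log 2 := Real.log_pos (by norm_num)
  set b := (k + 1) / γbar / x with hb
  have hb0 : 0 < b := by positivity
  set c := (ascPochhammer ℝ n).eval m / (n.factorial : ℝ) ^ 2 * fdWeight m k n x *
        Real.exp (-x) * (x * γbar / ((k + 1) * γ₀ * Real.log 2)) with hc
  have hc0 : 0 ≤ c := by positivity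
  calc _ ≤ ∫⁻ γ in Ioi γ₀, ENNReal.ofReal c *
        ENNReal.ofReal (b * (b * γ) ^ (n + 1) * Real.exp (-(b * γ))) := by
        refine setLIntegral_mono (by fun_prop) fun γ hγ => ?_
        rw [mem_Ioi] at hγ
        have hγ0 : 0 < γ := hγ₀.trans hγ
        rw [← ENNReal.ofReal_mul hc0]
        refine ENNReal.ofReal_le_ofReal ?_
        have hlog : Real.logb 2 (γ / γ₀) ≤ γ / γ₀ / Real.log 2 := by
          rw [Real.logb]
          gcongr
          exact Real.log_le_self (by positivity)
        calc opraTerm m k γbar γ₀ n (γ, x) ≤ γ / γ₀ / Real.log 2 * fdJointTerm m k γbar n γ x :=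
              mul_le_mul_of_nonneg_right hlog (fdJointTerm_nonneg hm hk hγbar hγ0 hx n)
          _ = c * (b * (b * γ) ^ (n + 1) * Real.exp (-(b * γ))) := by
              rw [fdJointTerm, ← hb, hc, pow_succ]
              have : x * γbar / ((k + 1) * γ₀ * Real.log 2) = 1 / (b * γ₀ * Real.log 2) := by
                rw [hb]; field_simp
              rw [this]
              field_simp
              ring
    _ ≤ ∫⁻ γ in Ioi 0, ENNReal.ofReal c *
        ENNReal.ofReal (b * (b * γ) ^ (n + 1) * Real.exp (-(b * γ))) :=
        lintegral_mono_set (Ioi_subset_Ioi hγ₀.le)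
    _ = _ := by
        rw [lintegral_const_mul _ (by fun_prop), lintegral_pow_mul_exp_neg hb0,
          ← ENNReal.ofReal_mul hc0]

theorem tsum_lintegral_opraTerm_ne_top {m k γbar γ₀ : ℝ} (hm : 0 < m) (hk : 0 < k)
    (hγbar : 0 < γbar) (hγ₀ : 0 < γ₀) :
    ∑' n : ℕ, ∫⁻ p, ‖opraTerm m k γbar γ₀ n p‖ₑ
      ∂((volume.restrict (Ioi γ₀)).prod (volume.restrict (Ioi 0))) ≠ ⊤ := by
  have hl : 0 < Real.log 2 := Real.log_pos (by norm_num)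
  set D := γbar / ((k + 1) * γ₀ * Real.log 2) with hD
  have hD0 : 0 < D := by positivity
  set K := max m 1 with hK
  have hK0 : 0 < K := lt_of_lt_of_le one_pos (le_max_right m 1)
  have hterm : ∀ n : ℕ, ∫⁻ p, ‖opraTerm m k γbar γ₀ n p‖ₑ
      ∂((volume.restrict (Ioi γ₀)).prod (volume.restrict (Ioi 0))) ≤
      ∫⁻ x in Ioi (0 : ℝ), ENNReal.ofReal ((ascPochhammer ℝ n).eval (m + 1) / n.factorial *
        ((1 + m * x / k)⁻¹) ^ n *
        (K * ((m * x / k) ^ m * (1 + m * x / k) ^ (-m)) * Real.exp (-x) * (x * D))) := by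
    intro n
    rw [lintegral_prod_symm' _ (measurable_opraTerm m k γbar γ₀ n).enorm]
    refine setLIntegral_mono' measurableSet_Ioi fun x hx => ?_
    rw [mem_Ioi] at hx
    have hw := fdWeight_nonneg hm hk hx n
    have hcongr : ∀ γ ∈ Ioi γ₀, ‖opraTerm m k γbar γ₀ n (γ, x)‖ₑ =
        ENNReal.ofReal (opraTerm m k γbar γ₀ n (γ, x)) := fun γ hγ =>
      Real.enorm_of_nonneg (opraTerm_nonneg hm hk hγbar hγ₀ hγ hx n)
    rw [setLIntegral_congr_fun measurableSet_Ioi hcongr]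
    refine (lintegral_opraTerm_le hm hk hγbar hγ₀ hx n).trans (ENNReal.ofReal_le_ofReal ?_)
    have e4 : fdWeight m k n x = ((m * x / k) ^ m * (1 + m * x / k) ^ (-m)) *
        ((1 + m * x / k)⁻¹) ^ n := by
      rw [fdWeight, neg_add, Real.rpow_add (by positivity), Real.rpow_neg _ (n : ℝ),
        Real.rpow_natCast, inv_pow]
      · ring
      · positivity
    have hfact : ((n + 1).factorial : ℝ) = (n + 1) * n.factorial := by
      rw [Nat.factorial_succ]; push_cast; ring
    have hle := ascPochhammer_mul_succ_le hm n
    have hfac : (0 : ℝ) < n.factorial := by positivity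
    calc _ = ((ascPochhammer ℝ n).eval m * (n + 1)) * (fdWeight m k n x * Real.exp (-x) *
          (x * D) / n.factorial) := by
          rw [hfact, hD]; field_simp
      _ ≤ (K * (ascPochhammer ℝ n).eval (m + 1)) * (fdWeight m k n x * Real.exp (-x) *
          (x * D) / n.factorial) := by gcongr
      _ = _ := by rw [e4]; field_simp
  refine ne_top_of_le_ne_top ?_ (ENNReal.tsum_le_tsum hterm)
  rw [← lintegral_tsum (fun n => Measurable.aemeasurable (by fun_prop))]
  -- With q = mx/k the binomial series at 1/(1+q) sums to (q/(1+q))^{-(m+1)}. The weight (q/(1+q))^m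
  -- cancels all but (1+q)/q, and x(1+q)/q = k/m + x.
  have hsum : ∀ x ∈ Ioi (0 : ℝ), ∑' n : ℕ, ENNReal.ofReal ((ascPochhammer ℝ n).eval (m + 1) /
        n.factorial * ((1 + m * x / k)⁻¹) ^ n *
        (K * ((m * x / k) ^ m * (1 + m * x / k) ^ (-m)) * Real.exp (-x) * (x * D))) =
      ENNReal.ofReal (K * D * (k / m + x) * Real.exp (-x)) := by
    intro x hx
    rw [mem_Ioi] at hx
    set q := m * x / k with hq
    have hq0 : 0 < q := by positivity
    have hy : (1 + q)⁻¹ < 1 := inv_lt_one_of_one_lt₀ (by linarith)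
    have hs := (hasSum_ascPochhammer_div_factorial (m + 1) (by positivity) hy).mul_right
      (K * (q ^ m * (1 + q) ^ (-m)) * Real.exp (-x) * (x * D))
    rw [← ENNReal.ofReal_tsum_of_nonneg _ hs.summable, hs.tsum_eq]
    · congr 1
      have e : 1 - (1 + q)⁻¹ = q / (1 + q) := by field_simp; ring
      have e' : (q / (1 + q)) ^ (-(m + 1)) = (q ^ m)⁻¹ * (1 + q) ^ m * ((1 + q) / q) := by
        rw [Real.rpow_neg (by positivity), Real.rpow_add_one (by positivity),
          Real.div_rpow hq0.le (by positivity)]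
        have := Real.rpow_pos_of_pos hq0 m
        have : 0 < (1 + q) ^ m := by positivity
        field_simp
      have hx' : k / m + x = x * ((1 + q) / q) := by rw [hq]; field_simp
      rw [e, e', hx', Real.rpow_neg (by positivity)]
      have := Real.rpow_pos_of_pos hq0 m
      have : 0 < (1 + q) ^ m := by positivity
      field_simp
    · intro n
      have : 0 < (ascPochhammer ℝ n).eval (m + 1) := ascPochhammer_pos n _ (by linarith)
      positivity
  rw [setLIntegral_congr_fun measurableSet_Ioi hsum]
  have h0 : IntegrableOn (fun x : ℝ => x ^ (0 : ℝ) * Real.exp (-1 * x ^ (1 : ℝ))) (Ioi 0) :=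
    integrableOn_rpow_mul_exp_neg_mul_rpow (by norm_num) one_pos one_pos
  have h1 : IntegrableOn (fun x : ℝ => x ^ (1 : ℝ) * Real.exp (-1 * x ^ (1 : ℝ))) (Ioi 0) :=
    integrableOn_rpow_mul_exp_neg_mul_rpow (by norm_num) one_pos one_pos
  have hint : IntegrableOn (fun x : ℝ => K * D * (k / m + x) * Real.exp (-x)) (Ioi 0) := by
    have h := (h0.const_mul (K * D * (k / m))).add (h1.const_mul (K * D))
    refine IntegrableOn.congr_fun h (fun x _ => ?_) measurableSet_Ioi
    simp only [Pi.add_apply, Real.rpow_zero, Real.rpow_one, neg_one_mul]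
    ring
  refine ne_top_of_le_ne_top hint.2.ne (lintegral_mono fun x => ?_)
  exact Real.ofReal_le_enorm _

/-! ### Termwise integration and summation -/

/-- Substitute v = bγ; log⁺ encodes the cutoff, as it vanishes for γ ≤ γ₀. -/
theorem integral_logb_mul_pow_mul_exp_neg {γ₀ b : ℝ} (hγ₀ : 0 < γ₀) (hb : 0 < b) (n : ℕ) :
    ∫ γ in Ioi γ₀, Real.logb 2 (γ / γ₀) * (b * (b * γ) ^ n * Real.exp (-(b * γ))) =
      (Real.log 2)⁻¹ * ∫ v in Ioi (0 : ℝ), v ^ n * Real.exp (-v) *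
        Real.posLog (1 / (b * γ₀) * v) := by
  have h := integral_comp_mul_left_Ioi' (fun v : ℝ => v ^ n * Real.exp (-v) *
        Real.posLog (1 / (b * γ₀) * v)) 0 hb
  rw [mul_zero] at h
  rw [← h, smul_eq_mul, ← mul_assoc, ← integral_const_mul]
  have hz : ∀ γ ∈ Ioi (0 : ℝ) \ Ioi γ₀, (Real.log 2)⁻¹ * b * ((b * γ) ^ n * Real.exp (-(b * γ)) *
      Real.posLog (1 / (b * γ₀) * (b * γ))) = 0 := by
    rintro γ ⟨hγ, hγ'⟩
    rw [mem_Ioi] at hγ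
    rw [mem_Ioi, not_lt] at hγ'
    have e : 1 / (b * γ₀) * (b * γ) = γ / γ₀ := by field_simp
    rw [e, (Real.posLog_eq_zero_iff _).mpr, mul_zero, mul_zero]
    rw [abs_of_pos (by positivity), div_le_one hγ₀]
    exact hγ'
  rw [setIntegral_eq_of_subset_of_forall_sdiff_eq_zero measurableSet_Ioi
    (Ioi_subset_Ioi hγ₀.le) hz]
  refine setIntegral_congr_fun measurableSet_Ioi fun γ hγ => ?_
  rw [mem_Ioi] at hγ
  have hγ0 : 0 < γ := hγ₀.trans hγ
  have e : 1 / (b * γ₀) * (b * γ) = γ / γ₀ := by field_simp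
  have e' : Real.posLog (γ / γ₀) = Real.log (γ / γ₀) := by
    refine Real.posLog_eq_log ?_
    rw [abs_of_pos (by positivity), one_le_div hγ₀]
    exact hγ.le
  simp only [e, e', Real.logb]
  ring

theorem integrable_opraTerm {m k γbar γ₀ : ℝ} (hm : 0 < m) (hk : 0 < k) (hγbar : 0 < γbar)
    (hγ₀ : 0 < γ₀) (n : ℕ) : Integrable (opraTerm m k γbar γ₀ n)
      ((volume.restrict (Ioi γ₀)).prod (volume.restrict (Ioi 0))) :=
  ⟨(measurable_opraTerm m k γbar γ₀ n).aestronglyMeasurable, lt_top_iff_ne_top.mpr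
    (ENNReal.ne_top_of_tsum_ne_top (tsum_lintegral_opraTerm_ne_top hm hk hγbar hγ₀) n)⟩

theorem integral_opraTerm {m k γbar γ₀ : ℝ} (hm : 0 < m) (hk : 0 < k) (hγbar : 0 < γbar)
    (hγ₀ : 0 < γ₀) (n : ℕ) :
    ∫ p, opraTerm m k γbar γ₀ n p ∂((volume.restrict (Ioi γ₀)).prod (volume.restrict (Ioi 0))) =
      k / (Real.Gamma (m + 1) * Real.log 2) *
        (opraRealIntegral m (γbar * k / (γ₀ * (k + 1) * m)) (k / m) n / (n.factorial : ℝ) ^ 2) := by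
  have hl : 0 < Real.log 2 := Real.log_pos (by norm_num)
  rw [integral_prod_symm _ (integrable_opraTerm hm hk hγbar hγ₀ n)]
  set c := (ascPochhammer ℝ n).eval m / (n.factorial : ℝ) ^ 2 with hc
  set g : ℝ → ℝ := fun y => y ^ m * (1 + y) ^ (-(m + n)) * (∫ v in Ioi (0 : ℝ),
    v ^ n * Real.exp (-v) * Real.posLog (γbar * k / (γ₀ * (k + 1) * m) * y * v)) *
      Real.exp (-(k / m * y)) with hg
  have hinner : ∀ x ∈ Ioi (0 : ℝ), ∫ γ in Ioi γ₀, opraTerm m k γbar γ₀ n (γ, x) =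
      c * (Real.log 2)⁻¹ * g (m / k * x) := by
    intro x hx
    rw [mem_Ioi] at hx
    have e : ∀ γ : ℝ, opraTerm m k γbar γ₀ n (γ, x) = c * fdWeight m k n x * Real.exp (-x) *
        (Real.logb 2 (γ / γ₀) * ((k + 1) / γbar / x * ((k + 1) / γbar / x * γ) ^ n *
          Real.exp (-((k + 1) / γbar / x * γ)))) := by
      intro γ
      rw [opraTerm, fdJointTerm]
      ring
    simp only [e]
    rw [integral_const_mul, integral_logb_mul_pow_mul_exp_neg hγ₀ (by positivity)]
    have e1 : γbar * k / (γ₀ * (k + 1) * m) * (m / k * x) = 1 / ((k + 1) / γbar / x * γ₀) := by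
      field_simp
    have e2 : k / m * (m / k * x) = x := by field_simp
    have e3 : m / k * x = m * x / k := by ring
    simp only [hg]
    rw [e1, e2, e3, fdWeight]
    ring
  -- The substitution y = mx/k has Jacobian k/m. Together with (m)_n = Γ(m+n)/Γ(m) and mΓ(m) =
  -- Γ(m+1) it produces the prefactor k/Γ(m+1).
  rw [setIntegral_congr_fun measurableSet_Ioi hinner, integral_const_mul,
    integral_comp_mul_left_Ioi g 0 (by positivity : 0 < m / k), mul_zero, opraRealIntegral, ← hg,
    smul_eq_mul, Real.Gamma_add_one hm.ne', hc]
  have hΓ : 0 < Real.Gamma (m + n) := Real.Gamma_pos_of_pos (by positivity)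
  have hΓ' : 0 < Real.Gamma m := Real.Gamma_pos_of_pos hm
  have hp := ascPochhammer_eval_div_Gamma hm n
  rw [div_eq_iff hΓ.ne'] at hp
  rw [hp]
  field_simp

theorem opraIntegrand_eq_integral_tsum {m k γbar γ₀ : ℝ} (hm : 0 < m) (hk : 0 < k)
    (hγbar : 0 < γbar) (γ : ℝ) :
    opraIntegrand m k γbar γ₀ γ = ∫ x in Ioi (0 : ℝ), ∑' n : ℕ, opraTerm m k γbar γ₀ n (γ, x) := by
  rw [opraIntegrand, fdRLoSPDF, ← integral_const_mul]
  refine setIntegral_congr_fun measurableSet_Ioi fun x hx => ?_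
  simp only [opraTerm]
  rw [fdRLoSCondPDF_mul_exp_eq_tsum hm hk hγbar hx, tsum_mul_left]

theorem integrableOn_opraIntegrand_and_hasSum {m k γbar γ₀ : ℝ} (hm : 0 < m) (hk : 0 < k)
    (hγbar : 0 < γbar) (hγ₀ : 0 < γ₀) :
    IntegrableOn (opraIntegrand m k γbar γ₀) (Ioi γ₀) ∧
    HasSum (fun n : ℕ => k / (Real.Gamma (m + 1) * Real.log 2) *
      (opraRealIntegral m (γbar * k / (γ₀ * (k + 1) * m)) (k / m) n / (n.factorial : ℝ) ^ 2))
      (opraCapacity m k γbar γ₀) := by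
  have htop := tsum_lintegral_opraTerm_ne_top hm hk hγbar hγ₀
  have hnorm : Summable fun n : ℕ => ∫ p, ‖opraTerm m k γbar γ₀ n p‖
      ∂((volume.restrict (Ioi γ₀)).prod (volume.restrict (Ioi 0))) := by
    refine (ENNReal.summable_toReal htop).congr fun n => ?_
    rw [integral_norm_eq_lintegral_enorm (integrable_opraTerm hm hk hγbar hγ₀ n).1]
  have hsum := hasSum_integral_of_summable_integral_norm
    (integrable_opraTerm hm hk hγbar hγ₀) hnorm
  have hint : Integrable (fun p => ∑' n : ℕ, opraTerm m k γbar γ₀ n p)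
      ((volume.restrict (Ioi γ₀)).prod (volume.restrict (Ioi 0))) := by
    refine ⟨(Measurable.tsum fun n => measurable_opraTerm m k γbar γ₀ n).aestronglyMeasurable, ?_⟩
    refine lt_of_le_of_lt (lintegral_mono fun p => enorm_tsum_le_tsum_enorm) ?_
    rw [lintegral_tsum fun n => (measurable_opraTerm m k γbar γ₀ n).enorm.aemeasurable]
    exact lt_top_iff_ne_top.mpr htop
  have hfun : opraIntegrand m k γbar γ₀ = fun γ => ∫ x in Ioi (0 : ℝ),
      ∑' n : ℕ, opraTerm m k γbar γ₀ n (γ, x) :=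
    funext fun γ => opraIntegrand_eq_integral_tsum hm hk hγbar γ
  constructor
  · rw [hfun]
    exact hint.integral_prod_left
  · rw [opraCapacity, hfun, ← integral_prod _ hint]
    simpa only [integral_opraTerm hm hk hγbar hγ₀] using hsum

theorem theorem5 (m k γbar γ₀ : ℝ) (hm : 0 < m) (hk : 0 < k) (hγbar : 0 < γbar)
    (hγ₀ : IsOPRACutoff m k γbar γ₀) :
    IntegrableOn (opraIntegrand m k γbar γ₀) (Ioi γ₀) ∧
    (∀ i : ℕ, ∃ G : ℂ, HasEGBMG (opraBlock₁ m i) (opraBlock₂ i) opraBlock₃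
      ((γbar * k / (γ₀ * (k + 1) * m) : ℝ) : ℂ) ((k / m : ℝ) : ℂ) G) ∧
    Summable (fun i : ℕ => egbmg (opraBlock₁ m i) (opraBlock₂ i) opraBlock₃
      ((γbar * k / (γ₀ * (k + 1) * m) : ℝ) : ℂ) ((k / m : ℝ) : ℂ) / (i.factorial : ℂ) ^ 2) ∧
    (opraCapacity m k γbar γ₀ : ℂ) =
      ((k / (Real.Gamma (m + 1) * Real.log 2) : ℝ) : ℂ) *
        ∑' i : ℕ, egbmg (opraBlock₁ m i) (opraBlock₂ i) opraBlock₃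
          ((γbar * k / (γ₀ * (k + 1) * m) : ℝ) : ℂ) ((k / m : ℝ) : ℂ) / (i.factorial : ℂ) ^ 2 := by
  obtain ⟨hγ₀, -⟩ := hγ₀
  have hG := fun i : ℕ => hasEGBMG_opra (m := m) (X := γbar * k / (γ₀ * (k + 1) * m)) (Y := k / m)
    hm (by positivity) (by positivity) i
  obtain ⟨hint, hsum⟩ := integrableOn_opraIntegrand_and_hasSum hm hk hγbar hγ₀
  have hl : 0 < Real.log 2 := Real.log_pos (by norm_num)
  have hΓ : 0 < Real.Gamma (m + 1) := Real.Gamma_pos_of_pos (by linarith)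
  have hc : k / (Real.Gamma (m + 1) * Real.log 2) ≠ 0 := by positivity
  have hterm : ∀ i : ℕ, egbmg (opraBlock₁ m i) (opraBlock₂ i) opraBlock₃
      ((γbar * k / (γ₀ * (k + 1) * m) : ℝ) : ℂ) ((k / m : ℝ) : ℂ) / (i.factorial : ℂ) ^ 2 =
      ((opraRealIntegral m (γbar * k / (γ₀ * (k + 1) * m)) (k / m) i / (i.factorial : ℝ) ^ 2 : ℝ) :
        ℂ) := fun i => by
    rw [(hG i).egbmg_eq]
    push_cast
    rfl
  refine ⟨hint, fun i => ⟨_, hG i⟩, ?_, ?_⟩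
  · simp only [hterm]
    exact Complex.ofRealCLM.summable ((summable_mul_left_iff hc).mp hsum.summable)
  · simp only [hterm]
    rw [← Complex.ofReal_tsum, ← Complex.ofReal_mul, ← hsum.tsum_eq, tsum_mul_left]
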